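/- Let $n\ge 3$ robots have positions $x_i\in\mathbb R^3$ (indices $i$ modulo $n$) and stacked state $x=(x_1,\dots,x_n)\in\mathbb R^{3n}$. Let $R_\theta$ be the counterclockwise rotation by $\theta$ about $e_z=(0,0,1)^T$; let $L_m$ be the $n\times n$ circulant matrix $(L_mv)_i=v_i-v_{i+m}$; let $$P_n=L_1\otimes I_3+(L_1-L_2)\otimes R_{2\pi/n},$$ and let $$\mathcal M_n=\{x:\ x_{i+1}-x_i=R_{2\pi/n}(x_{i+2}-x_{i+1})\ (1\le i\le n-2),\ \ e_z^T(x_n-x_{n-1})=e_z^T(x_1-x_n)\}$$ be the subspace of regular polygons with normal $e_z$. Let $0<N<n-1$, let $k_m>0$ be gains and $\alpha_m\in\mathbb R$ angles ($1\le m\le N$), constant or depending on time $t\in\mathbb R$, and put $R_m=R_{\alpha_m}$. Let $g:\mathbb R^{3n}\to\mathbb R^{3n}$ be continuously differentiable with $g(\mathcal M_n)\subseteq\mathcal M_n$. Consider $$\dot x=g(x)+u,\qquad u=-\sum_{m=1}^N k_m\,(L_m\otimes R_m+L_m^T\otimes R_m^T)\,x .$$ For $1\le i\le n$ and $k\in\{-1,0,1\}$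 let (with $j=\sqrt{-1}$) $$\lambda^{(m)}_{ik}=\frac{2}{e^{2\pi(2(i-1)+k)j/n}}\Big[\cos(k\alpha_m)-\cos\big(k\alpha_m+\tfrac{2\pi m(i-1)}{n}\big)\Big]\Big[\big(e^{2\pi(i-1+k)j/n}-1\big)\big(e^{2\pi(i-1)j/n}-1\big)\Big]^2 ,$$ which is a real number. Let $S$ be the set of pairs $(i,k)$, $1\le i\le n$, $k\in\{-1,0,1\}$, with $i-1\not\equiv0$ and $i-1+k\not\equiv 0 \pmod n$, i.e. all pairs except $(1,-1),(1,0),(1,1),(2,-1),(n,1)$, which are the modes spanning $\mathcal M_n$. For a real square matrix $A$ let $\lambda_{\max}(A)$ be the largest eigenvalue of $\frac12(A+A^T)$. If $$\sup_{x,t}\Big(\lambda_{\max}\Big(P_n\frac{\partial g}{\partial x}P_n^T\Big)-\min_{(i,k)\in S}\sum_{m=1}^N k_m\lambda^{(m)}_{ik}\Big)<0 ,$$ then all trajectories converge globally and exponentially to $\mathcal M_n$: there are constants $c>0$ and $K>0$ such that every solution $x$ on an interval $[t_0,T)$, $T\le\infty$, satisfies $\operatorname{dist}(x(t),\mathcal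 M_n)\le K e^{-c(t-t_0)}\operatorname{dist}(x(t_0),\mathcal M_n)$ for all $t\in[t_0,T)$. -/

import Mathlib

open scoped Matrix Kronecker

namespace CyclicPursuit

/-- The state space `ℝ^{3n}` with its Euclidean norm. Robots are labelled by `ZMod n`: robot
number `i ∈ {1, …, n}` has label `i - 1`, so sums of labels are automatically modulo `n`.
The coordinate `(i, a)` of a state is the `a`-th coordinate of the position of robot `i`. -/
abbrev State (n : ℕ) : Type := EuclideanSpace ℝ (ZMod n × Fin 3)

/-- Square matrices acting on the state space. -/
abbrev StateMatrix (n : ℕ) : Type := Matrix (ZMod n × Fin 3) (ZMod n × Fin 3) ℝ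

/-- The position in `ℝ³` of robot `i`. -/
def pos {n : ℕ} (x : State n) (i : ZMod n) : Fin 3 → ℝ := fun a => x (i, a)

/-- Counterclockwise rotation by the angle `θ` around the third coordinate axis. -/
noncomputable def rot (θ : ℝ) : Matrix (Fin 3) (Fin 3) ℝ :=
  !![Real.cos θ, -Real.sin θ, 0; Real.sin θ, Real.cos θ, 0; 0, 0, 1]

/-- The circulant matrix with first row `c`; every row is the previous one shifted to the right. -/
def circ {n : ℕ} (c : ZMod n → ℝ) : Matrix (ZMod n) (ZMod n) ℝ := Matrix.of fun i j => c (j - i)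

/-- `L_m = circ[1, 0, …, 0, -1, 0, …, 0]` with `-1` at the `(m+1)`-st place. -/
def L (n m : ℕ) : Matrix (ZMod n) (ZMod n) ℝ :=
  circ (Pi.single (0 : ZMod n) (1 : ℝ) - Pi.single (m : ZMod n) (1 : ℝ))

/-- `P_n = L₁ ⊗ I₃ + (L₁ - L₂) ⊗ R_{2π/n}`. -/
noncomputable def P (n : ℕ) : StateMatrix n :=
  L n 1 ⊗ₖ (1 : Matrix (Fin 3) (Fin 3) ℝ) + (L n 1 - L n 2) ⊗ₖ rot (2 * Real.pi / n)

/-- The formation subspace `M_n` of regular polygons with normal direction `e_z`: the first `n - 2`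
rotational constraints together with the single in-plane constraint. -/
noncomputable def formation (n : ℕ) : Submodule ℝ (State n) where
  carrier := {x |
    (∀ i : ZMod n, i.val + 2 < n →
      pos x (i + 1) - pos x i = rot (2 * Real.pi / n) *ᵥ (pos x (i + 2) - pos x (i + 1))) ∧
    (pos x (-1) - pos x (-2)) 2 = (pos x 0 - pos x (-1)) 2}
  add_mem' := by
    rintro x y ⟨hx, hx'⟩ ⟨hy, hy'⟩
    have hp : ∀ i, pos (x + y) i = pos x i + pos y i := fun i => by ext a; simp [pos]
    refine ⟨fun i hi => ?_, ?_⟩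
    · rw [hp, hp, hp, add_sub_add_comm, hx i hi, hy i hi, ← Matrix.mulVec_add, add_sub_add_comm]
    · simp only [hp, Pi.sub_apply, Pi.add_apply] at hx' hy' ⊢
      linarith
  zero_mem' := by
    have hp : ∀ i, pos (0 : State n) i = 0 := fun i => by ext a; simp [pos]
    simp [hp]
  smul_mem' := by
    rintro c x ⟨hx, hx'⟩
    have hp : ∀ i, pos (c • x) i = c • pos x i := fun i => by ext a; simp [pos]
    refine ⟨fun i hi => ?_, ?_⟩
    · rw [hp, hp, hp, ← smul_sub, hx i hi, ← smul_sub, Matrix.mulVec_smul]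
    · simp only [hp, Pi.sub_apply, Pi.smul_apply, smul_eq_mul] at hx' ⊢
      linear_combination c * hx'

/-- The matrix `𝓛 = ∑_{m=1}^N k_m (L_m ⊗ R_m + L_mᵀ ⊗ R_mᵀ)`, where `R_m` is the rotation by the
angle `α m` around the third axis. -/
noncomputable def cyclicMatrix (n N : ℕ) (k α : ℕ → ℝ) : StateMatrix n :=
  ∑ m ∈ Finset.Icc 1 N, k m • (L n m ⊗ₖ rot (α m) + (L n m)ᵀ ⊗ₖ (rot (α m))ᵀ)

/-- The symmetric cyclic pursuit controller `u = -𝓛 x`. -/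
noncomputable def cyclicControl (n N : ℕ) [NeZero n] (k α : ℕ → ℝ) (x : State n) : State n :=
  WithLp.toLp 2 (-(cyclicMatrix n N k α *ᵥ x.ofLp))

/-- The controller, robot by robot:
`u_i = ∑_{m=1}^N k_m [R_m (x_{i+m} - x_i) + R_mᵀ (x_{i-m} - x_i)]`. -/
theorem pos_cyclicControl (n N : ℕ) [NeZero n] (k α : ℕ → ℝ) (x : State n) (i : ZMod n) :
    pos (cyclicControl n N k α x) i = ∑ m ∈ Finset.Icc 1 N, k m •
      (rot (α m) *ᵥ (pos x (i + m) - pos x i) + (rot (α m))ᵀ *ᵥ (pos x (i - m) - pos x i)) := by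
  have key : ∀ (m : ℕ) (A B : Matrix (Fin 3) (Fin 3) ℝ) (a : Fin 3),
      ((L n m ⊗ₖ A + (L n m)ᵀ ⊗ₖ B) *ᵥ x.ofLp) (i, a) =
      -((A *ᵥ (pos x (i + m) - pos x i) + B *ᵥ (pos x (i - m) - pos x i)) a) := by
    intro m A B a
    have h1 : ∀ j : ZMod n, L n m i j = (if j = i then 1 else 0) - (if j = i + m then 1 else 0) := by
      intro j
      simp [L, circ, Pi.single_apply, sub_eq_iff_eq_add, add_comm]
    have h2 : ∀ j : ZMod n, L n m j i = (if j = i then 1 else 0) - (if j = i - m then 1 else 0) := by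
      intro j
      have e1 : (i = j) ↔ (j = i) := eq_comm
      have e2 : (i = (m : ZMod n) + j) ↔ (j = i - m) := by
        constructor <;> intro h
        · rw [h]; ring
        · rw [h]; ring
      simp [L, circ, Pi.single_apply, sub_eq_iff_eq_add, e1, e2]
    simp only [Matrix.mulVec, dotProduct, Fintype.sum_prod_type, Matrix.add_apply,
      Matrix.kroneckerMap_apply, Matrix.transpose_apply, h1, h2, pos, Pi.sub_apply, Pi.add_apply]
    rw [Finset.sum_comm]
    simp only [add_mul, sub_mul, ite_mul, one_mul, zero_mul, Finset.sum_add_distrib,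
      Finset.sum_sub_distrib, Finset.sum_ite_eq', Finset.mem_univ, if_true, mul_sub]
    ring
  ext a
  simp only [pos, cyclicControl, cyclicMatrix, Matrix.sum_mulVec, Matrix.smul_mulVec, Pi.neg_apply,
    Finset.sum_apply, Pi.smul_apply, smul_eq_mul, ← Finset.sum_neg_distrib]
  refine Finset.sum_congr rfl fun m _ => ?_
  rw [key m]
  simp only [Pi.add_apply]
  ring

/-- The Jacobian matrix `∂g/∂x` at `x`. -/
noncomputable def jacobian {n : ℕ} [NeZero n] (g : State n → State n) (x : State n) :
    StateMatrix n :=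
  Matrix.of fun p q => fderiv ℝ g x (EuclideanSpace.single q 1) p

/-- The symmetric part `(A + Aᵀ) / 2` of a square matrix. -/
noncomputable def symPart {ι : Type*} (A : Matrix ι ι ℝ) : Matrix ι ι ℝ :=
  (1 / 2 : ℝ) • (A + Aᵀ)

theorem symPart_isHermitian {ι : Type*} (A : Matrix ι ι ℝ) : (symPart A).IsHermitian := by
  ext i j
  simp only [symPart, Matrix.conjTranspose_apply, Matrix.smul_apply, Matrix.add_apply,
    Matrix.transpose_apply, star_trivial, add_comm]

/-- `λ_max(A)`: the largest eigenvalue of the symmetric part of `A`. -/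
noncomputable def lambdaMax {ι : Type*} [Fintype ι] [DecidableEq ι] (A : Matrix ι ι ℝ) : ℝ :=
  ⨆ i, (symPart_isHermitian A).eigenvalues i

/-- The number `λ_{ik}^{(m)}` for the rotation angle `a = α_m`, as a complex number. -/
noncomputable def modeEigenvalueC (n m : ℕ) (a : ℝ) (i k : ℤ) : ℂ :=
  2 / Complex.exp (2 * Real.pi * (2 * ((i : ℂ) - 1) + k) * Complex.I / n) *
    ((Real.cos (k * a) - Real.cos (k * a + 2 * Real.pi * m * ((i : ℝ) - 1) / n) : ℝ) : ℂ) *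
    ((Complex.exp (2 * Real.pi * ((i : ℂ) - 1 + k) * Complex.I / n) - 1) *
      (Complex.exp (2 * Real.pi * ((i : ℂ) - 1) * Complex.I / n) - 1)) ^ 2

/-- The real number `λ_{ik}^{(m)}`. -/
noncomputable def modeEigenvalue (n m : ℕ) (a : ℝ) (i k : ℤ) : ℝ :=
  (modeEigenvalueC n m a i k).re

/-- `λ_{ik}^{(m)}` is indeed real. -/
theorem modeEigenvalue_eq (n m : ℕ) (a : ℝ) (i k : ℤ) :
    (modeEigenvalue n m a i k : ℂ) = modeEigenvalueC n m a i k := by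
  have hsq : ∀ s : ℝ, (Complex.exp (s * Complex.I) - 1) ^ 2 =
      Complex.exp (s * Complex.I) * ((2 * Real.cos s - 2 : ℝ) : ℂ) := by
    intro s
    have h : Complex.exp (s * Complex.I) * Complex.exp (-s * Complex.I) = 1 := by
      rw [← Complex.exp_add]; simp
    push_cast
    rw [Complex.two_cos]
    linear_combination (-1 : ℂ) * h
  have h1 := hsq (2 * Real.pi * ((i : ℝ) - 1 + k) / n)
  have h2 := hsq (2 * Real.pi * ((i : ℝ) - 1) / n)
  have h3 : Complex.exp (2 * Real.pi * (2 * ((i : ℂ) - 1) + k) * Complex.I / n) =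
      Complex.exp (((2 * Real.pi * ((i : ℝ) - 1 + k) / n : ℝ) : ℂ) * Complex.I) *
        Complex.exp (((2 * Real.pi * ((i : ℝ) - 1) / n : ℝ) : ℂ) * Complex.I) := by
    rw [← Complex.exp_add]; congr 1; push_cast; ring
  have h4 : Complex.exp (2 * Real.pi * ((i : ℂ) - 1 + k) * Complex.I / n) =
      Complex.exp (((2 * Real.pi * ((i : ℝ) - 1 + k) / n : ℝ) : ℂ) * Complex.I) := by
    congr 1; push_cast; ring
  have h5 : Complex.exp (2 * Real.pi * ((i : ℂ) - 1) * Complex.I / n) =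
      Complex.exp (((2 * Real.pi * ((i : ℝ) - 1) / n : ℝ) : ℂ) * Complex.I) := by
    congr 1; push_cast; ring
  obtain ⟨r, hr⟩ : ∃ r : ℝ, modeEigenvalueC n m a i k = r := by
    refine ⟨2 * (Real.cos (k * a) - Real.cos (k * a + 2 * Real.pi * m * ((i : ℝ) - 1) / n)) *
      (2 * Real.cos (2 * Real.pi * ((i : ℝ) - 1 + k) / n) - 2) *
      (2 * Real.cos (2 * Real.pi * ((i : ℝ) - 1) / n) - 2), ?_⟩
    rw [modeEigenvalueC, h3, h4, h5, mul_pow, h1, h2]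
    have n1 := Complex.exp_ne_zero
      (((2 * Real.pi * ((i : ℝ) - 1 + k) / n : ℝ) : ℂ) * Complex.I)
    have n2 := Complex.exp_ne_zero (((2 * Real.pi * ((i : ℝ) - 1) / n : ℝ) : ℂ) * Complex.I)
    generalize Complex.exp (((2 * Real.pi * ((i : ℝ) - 1 + k) / n : ℝ) : ℂ) * Complex.I) = A at *
    generalize Complex.exp (((2 * Real.pi * ((i : ℝ) - 1) / n : ℝ) : ℂ) * Complex.I) = B at *
    rw [Complex.ofReal_mul, Complex.ofReal_mul, Complex.ofReal_mul]
    field_simp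
    push_cast
    ring
  rw [modeEigenvalue, hr, Complex.ofReal_re]

/-- The pairs `(i, k)`, `1 ≤ i ≤ n`, `k ∈ {-1, 0, 1}`, whose mode does not lie in the formation
subspace, that is, for which `i - 1` and `i - 1 + k` are both nonzero modulo `n`. Excluded are
`(1, -1)`, `(1, 0)`, `(1, 1)`, `(2, -1)` and `(n, 1)`: the two exponential factors of `λ_{ik}^{(m)}`
vanish there, these are the five zero eigenvalues of `P_n`, and their modes span the
five-dimensional subspace `M_n`. -/
noncomputable def transverseModes (n : ℕ) : Finset (ℤ × ℤ) :=
  (Finset.Icc (1 : ℤ) n ×ˢ Finset.Icc (-1 : ℤ) 1).filter fun p =>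
    ¬ (n : ℤ) ∣ p.1 - 1 ∧ ¬ (n : ℤ) ∣ p.1 - 1 + p.2

theorem transverseModes_nonempty {n : ℕ} (hn : 3 ≤ n) : (transverseModes n).Nonempty := by
  refine ⟨(2, 0), ?_⟩
  have h : ¬ (n : ℤ) ∣ 1 := fun h => by
    have := Int.le_of_dvd one_pos h
    omega
  simp only [transverseModes, Finset.mem_filter, Finset.mem_product, Finset.mem_Icc]
  refine ⟨⟨⟨by norm_num, by omega⟩, by norm_num, by norm_num⟩, ?_, ?_⟩ <;> norm_num <;> omega

/-- The minimum of `∑_{m=1}^N k_m λ_{ik}^{(m)}` over the modes `(i, k)` transverse to `M_n`. -/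
noncomputable def minModeSum (n N : ℕ) (hn : 3 ≤ n) (k α : ℕ → ℝ) : ℝ :=
  (transverseModes n).inf' (transverseModes_nonempty hn) fun p =>
    ∑ m ∈ Finset.Icc 1 N, k m * modeEigenvalue n m (α m) p.1 p.2

/-- The time interval `[t₀, T)`, where `T = ∞` is allowed. -/
def timeInterval (t₀ : ℝ) (T : EReal) : Set ℝ := {t | t₀ ≤ t ∧ (t : EReal) < T}

/-- `x` is a trajectory of `ẋ = f(t, x)` on the time interval `[t₀, T)`. -/
def IsTrajectory {E : Type*} [NormedAddCommGroup E] [NormedSpace ℝ E] (f : ℝ → E → E)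
    (t₀ : ℝ) (T : EReal) (x : ℝ → E) : Prop :=
  ∀ t ∈ timeInterval t₀ T, HasDerivWithinAt x (f t (x t)) (timeInterval t₀ T) t

end CyclicPursuit

open CyclicPursuit

/-!
Let `Q` be the orthogonal projection onto the orthogonal complement of the formation subspace `M`,
so that the distance of `x` to `M` is `‖Q x‖`. It decays exponentially because
`⟪Q x, g x + u⟫ ≤ -c ‖Q x‖²`, and this is where the matrix `P = P_n` enters.

* The kernel of `P` is `M`, so `Mᗮ` is the range of `Pᵀ`, which is also the range of `Pᵀ P`. Hence
  `y = Q x` can be written `y = Pᵀ z` with `z` in the range of `P`.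
* As `g` maps `x - y ∈ M` into `M`, the mean value theorem gives
  `⟪y, g x⟫ = ⟪y, g x - g (x - y)⟫ = zᵀ P J Pᵀ z` with `J` the Jacobian at a point of the segment
  from `x - y` to `x`. This is at most `λ_max(P J Pᵀ) ‖z‖²`.
* `𝓛` commutes with `P`, so it preserves `M` and `⟪y, u⟫ = -zᵀ P 𝓛 Pᵀ z`. The discrete Fourier
  transform in the robot index, combined with the eigenvectors of the rotations, diagonalizes
  `P`, `Pᵀ` and `𝓛` at once. The eigenvalues of `P 𝓛 Pᵀ` are `∑ k_m λ_{ik}^{(m)}`, and a vector `z`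
  in the range of `P` has components only along the modes at which `P` does not vanish, which are
  the transverse ones. So `zᵀ P 𝓛 Pᵀ z` is at least the minimal mode sum times `‖z‖²`
  (`minModeSum_mul_le`).

Adding up, `⟪y, g x + u⟫ ≤ -ε ‖z‖² ≤ -(ε / C) ‖y‖²` where `-ε` bounds the supremum in the
contraction condition and `‖Pᵀ z‖² ≤ C ‖z‖²` (`inner_starProjection_le`).

That all of `M` lies in the kernel of `P` (`P_mulVec_eq_zero_of_mem_formation`) also needs an
argument: the definition of `M` leaves out the constraints that follow from closing the polygon.
-/

namespace CyclicPursuit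

open ZMod

variable {n : ℕ} [NeZero n]

/-! ### Fourier modes of the state space -/

lemma sum_conj_dft_mul_dft (f g : ZMod n → ℂ) :
    ∑ q, (starRingEnd ℂ) (𝓕 f q) * 𝓕 g q = n * ∑ j, (starRingEnd ℂ) (f j) * g j := by
  have h : ∀ q, (starRingEnd ℂ) (𝓕 f q) = ∑ j, stdAddChar (j * q) * (starRingEnd ℂ) (f j) := by
    intro q
    simp only [dft_apply, map_sum, smul_eq_mul, map_mul, ← AddChar.map_neg_eq_conj, neg_neg]
  calc ∑ q, (starRingEnd ℂ) (𝓕 f q) * 𝓕 g q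
      = ∑ j, (starRingEnd ℂ) (f j) * 𝓕 (𝓕 g) (-j) := by
        simp only [h, Finset.sum_mul]
        rw [Finset.sum_comm]
        refine Finset.sum_congr rfl fun j _ => ?_
        rw [dft_apply, Finset.mul_sum]
        refine Finset.sum_congr rfl fun q _ => ?_
        rw [smul_eq_mul, mul_neg, neg_neg, mul_comm q j]
        ring
    _ = n * ∑ j, (starRingEnd ℂ) (f j) * g j := by
        simp only [dft_dft, neg_neg, smul_eq_mul, Finset.mul_sum]
        exact Finset.sum_congr rfl fun j _ => by ring

lemma dft_comp_add (f : ZMod n → ℂ) (m q : ZMod n) :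
    𝓕 (fun j => f (j + m)) q = stdAddChar (m * q) * 𝓕 f q := by
  rw [dft_apply, dft_apply, Finset.mul_sum]
  refine Fintype.sum_equiv (Equiv.addRight m) _ _ fun j => ?_
  rw [Equiv.coe_addRight, smul_eq_mul, smul_eq_mul, ← mul_assoc, ← AddChar.map_add_eq_mul]
  congr 2
  ring

/-- For `k = 0, ±1`, the linear form on `ℝ³` (with complex values) that every rotation by `θ`
around the third axis multiplies by `exp (i k θ)`: the third coordinate for `k = 0` and
`v ↦ v₁ + i k v₂` for `k = ±1`. Other values of `k` are not used. -/
noncomputable def rotCovector (k : ℤ) (v : Fin 3 → ℝ) : ℂ :=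
  if k = 0 then (v 2 : ℂ) else v 0 + k * Complex.I * v 1

lemma rotCovector_sub (k : ℤ) (v w : Fin 3 → ℝ) :
    rotCovector k (v - w) = rotCovector k v - rotCovector k w := by
  unfold rotCovector
  split_ifs
  · simp
  · simp
    ring

lemma rotCovector_add (k : ℤ) (v w : Fin 3 → ℝ) :
    rotCovector k (v + w) = rotCovector k v + rotCovector k w := by
  unfold rotCovector
  split_ifs
  · simp
  · simp
    ring

lemma rotCovector_smul (k : ℤ) (c : ℝ) (v : Fin 3 → ℝ) :
    rotCovector k (c • v) = c * rotCovector k v := by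
  unfold rotCovector
  split_ifs
  · simp
  · simp
    ring

lemma rotCovector_zero (k : ℤ) : rotCovector k 0 = 0 := by
  unfold rotCovector
  split_ifs <;> simp

lemma rotCovector_rot_mulVec {k : ℤ} (hk : k ∈ Finset.Icc (-1 : ℤ) 1) (θ : ℝ) (v : Fin 3 → ℝ) :
    rotCovector k (rot θ *ᵥ v) = Complex.exp ((k * θ : ℝ) * Complex.I) * rotCovector k v := by
  obtain ⟨h1, h2⟩ := Finset.mem_Icc.1 hk
  rw [Complex.exp_mul_I, ← Complex.ofReal_cos, ← Complex.ofReal_sin]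
  obtain rfl | rfl | rfl : k = -1 ∨ k = 0 ∨ k = 1 := by omega
  · simp [rotCovector, rot, Matrix.mulVec, dotProduct, Fin.sum_univ_three]
    linear_combination (-(Complex.sin θ : ℂ) * v 1) * Complex.I_sq
  · simp [rotCovector, rot, Matrix.mulVec, dotProduct, Fin.sum_univ_three]
  · simp [rotCovector, rot, Matrix.mulVec, dotProduct, Fin.sum_univ_three]
    linear_combination (-(Complex.sin θ : ℂ) * v 1) * Complex.I_sq

/-- The weight of the `k`-th covector in the expansion of the Euclidean inner product; the
covectors for `k = ±1` have norm `√2`. -/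
noncomputable def rotWeight (k : ℤ) : ℝ := if k = 0 then 1 else 1 / 2

lemma rotWeight_nonneg (k : ℤ) : 0 ≤ rotWeight k := by
  unfold rotWeight
  split_ifs <;> norm_num

lemma sum_rotCovector (v w : Fin 3 → ℝ) :
    ∑ k ∈ Finset.Icc (-1 : ℤ) 1,
      (rotWeight k : ℂ) * ((starRingEnd ℂ) (rotCovector k v) * rotCovector k w) =
      ((v ⬝ᵥ w : ℝ) : ℂ) := by
  have h : Finset.Icc (-1 : ℤ) 1 = {-1, 0, 1} := by decide
  rw [h]
  simp [rotCovector, rotWeight, dotProduct, Fin.sum_univ_three]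
  linear_combination (-(v 1 : ℂ) * w 1) * Complex.I_sq

/-- The Fourier coefficient of the state `z` at the spatial frequency `q` and the rotation
frequency `k`. -/
noncomputable def mode (k : ℤ) (q : ZMod n) (z : ZMod n × Fin 3 → ℝ) : ℂ :=
  𝓕 (fun i => rotCovector k (Function.curry z i)) q

lemma mode_add (k : ℤ) (q : ZMod n) (z w : ZMod n × Fin 3 → ℝ) :
    mode k q (z + w) = mode k q z + mode k q w := by
  have h : (fun i => rotCovector k (Function.curry (z + w) i)) =
      (fun i => rotCovector k (Function.curry z i)) +
        fun i => rotCovector k (Function.curry w i) :=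
    funext fun i => rotCovector_add k _ _
  rw [mode, h, map_add]
  rfl

lemma mode_smul (k : ℤ) (q : ZMod n) (c : ℝ) (z : ZMod n × Fin 3 → ℝ) :
    mode k q (c • z) = c * mode k q z := by
  have h : (fun i => rotCovector k (Function.curry (c • z) i)) =
      (c : ℂ) • (fun i => rotCovector k (Function.curry z i)) :=
    funext fun i => rotCovector_smul k c _
  rw [mode, h, _root_.map_smul]
  rfl

lemma mode_zero (k : ℤ) (q : ZMod n) : mode k q 0 = 0 := by
  simpa using mode_smul k q 0 0

/-- Parseval's identity. -/
lemma sum_mode_mul_mode (z w : ZMod n × Fin 3 → ℝ) :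
    ∑ k ∈ Finset.Icc (-1 : ℤ) 1, ∑ q : ZMod n,
      (rotWeight k : ℂ) * ((starRingEnd ℂ) (mode k q z) * mode k q w) =
      ((n * (z ⬝ᵥ w) : ℝ) : ℂ) := by
  simp only [mode, ← Finset.mul_sum, sum_conj_dft_mul_dft]
  have h : ((z ⬝ᵥ w : ℝ) : ℂ) =
      ∑ i, ((Function.curry z i ⬝ᵥ Function.curry w i : ℝ) : ℂ) := by
    simp [dotProduct, Fintype.sum_prod_type]
  rw [Complex.ofReal_mul, h]
  simp only [← sum_rotCovector]
  rw [Finset.sum_comm, Finset.mul_sum]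
  refine Finset.sum_congr rfl fun k _ => ?_
  rw [Finset.mul_sum, Finset.mul_sum, Finset.mul_sum, Complex.ofReal_natCast]
  exact Finset.sum_congr rfl fun i _ => by ring

lemma eq_zero_of_mode_eq_zero {z : ZMod n × Fin 3 → ℝ}
    (h : ∀ k ∈ Finset.Icc (-1 : ℤ) 1, ∀ q, mode k q z = 0) : z = 0 := by
  have h1 := sum_mode_mul_mode z z
  rw [Finset.sum_eq_zero fun k hk => Finset.sum_eq_zero fun q _ => by simp [h k hk q]] at h1
  have h2 : (n : ℝ) * (z ⬝ᵥ z) = 0 := by exact_mod_cast h1.symm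
  exact dotProduct_self_eq_zero.1 ((mul_eq_zero.1 h2).resolve_left (NeZero.ne _))

/-! ### Symbols of block circulant matrices -/

/-- The matrix `A` acts on the Fourier coefficients of states by multiplication with `s`. -/
def HasSymbol (A : StateMatrix n) (s : ℤ → ZMod n → ℂ) : Prop :=
  ∀ z, ∀ k ∈ Finset.Icc (-1 : ℤ) 1, ∀ q, mode k q (A *ᵥ z) = s k q * mode k q z

namespace HasSymbol

variable {A B : StateMatrix n} {s t : ℤ → ZMod n → ℂ}

lemma add (hA : HasSymbol A s) (hB : HasSymbol B t) :
    HasSymbol (A + B) (fun k q => s k q + t k q) := fun z k hk q => by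
  rw [Matrix.add_mulVec, mode_add, hA z k hk, hB z k hk, add_mul]

lemma smul (hA : HasSymbol A s) (c : ℝ) : HasSymbol (c • A) (fun k q => c * s k q) :=
  fun z k hk q => by rw [Matrix.smul_mulVec, mode_smul, hA z k hk, mul_assoc]

lemma mul (hA : HasSymbol A s) (hB : HasSymbol B t) :
    HasSymbol (A * B) (fun k q => s k q * t k q) := fun z k hk q => by
  rw [← Matrix.mulVec_mulVec, hA _ k hk, hB z k hk, mul_assoc]

lemma zero : HasSymbol (0 : StateMatrix n) (fun _ _ => 0) := fun z k _ q => by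
  rw [Matrix.zero_mulVec, mode_zero, zero_mul]

lemma sum {ι : Type*} (I : Finset ι) {A : ι → StateMatrix n} {s : ι → ℤ → ZMod n → ℂ}
    (h : ∀ m ∈ I, HasSymbol (A m) (s m)) :
    HasSymbol (∑ m ∈ I, A m) (fun k q => ∑ m ∈ I, s m k q) := by
  classical
  induction I using Finset.induction_on with
  | empty => simpa using zero
  | insert a I ha ih =>
    simp only [Finset.sum_insert ha]
    exact (h a (Finset.mem_insert_self _ _)).add
      (ih fun m hm => h m (Finset.mem_insert_of_mem hm))

lemma congr (hA : HasSymbol A s) (h : ∀ k ∈ Finset.Icc (-1 : ℤ) 1, ∀ q, s k q = t k q) :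
    HasSymbol A t := fun z k hk q => by rw [hA z k hk, h k hk]

lemma commute (hA : HasSymbol A s) (hB : HasSymbol B t) (z : ZMod n × Fin 3 → ℝ) :
    A *ᵥ (B *ᵥ z) = B *ᵥ (A *ᵥ z) := by
  rw [← sub_eq_zero]
  refine eq_zero_of_mode_eq_zero fun k hk q => ?_
  rw [sub_eq_add_neg, ← neg_one_smul ℝ, mode_add, mode_smul, hA _ k hk, hB _ k hk, hB _ k hk,
    hA _ k hk]
  push_cast
  ring

/-- A matrix with a real symbol has the quadratic form that the symbol predicts. -/
lemma dotProduct_mulVec {r : ℤ → ZMod n → ℝ} (hA : HasSymbol A fun k q => (r k q : ℂ))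
    (z : ZMod n × Fin 3 → ℝ) :
    n * (z ⬝ᵥ A *ᵥ z) = ∑ k ∈ Finset.Icc (-1 : ℤ) 1, ∑ q : ZMod n,
      rotWeight k * (r k q * Complex.normSq (mode k q z)) := by
  have h := sum_mode_mul_mode z (A *ᵥ z)
  apply Complex.ofReal_injective
  rw [← h]
  push_cast
  refine Finset.sum_congr rfl fun k hk => Finset.sum_congr rfl fun q _ => ?_
  rw [hA z k hk, Complex.normSq_eq_conj_mul_self]
  ring

end HasSymbol

lemma curry_L_kronecker_mulVec (m : ℕ) (A : Matrix (Fin 3) (Fin 3) ℝ)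
    (z : ZMod n × Fin 3 → ℝ) (i : ZMod n) :
    Function.curry ((L n m ⊗ₖ A) *ᵥ z) i =
      A *ᵥ (Function.curry z i - Function.curry z (i + m)) := by
  have h : ∀ j : ZMod n, L n m i j = (if j = i then 1 else 0) - (if j = i + m then 1 else 0) := by
    intro j
    simp [L, circ, Pi.single_apply, sub_eq_iff_eq_add, add_comm]
  ext a
  simp only [Function.curry, Matrix.mulVec, dotProduct, Fintype.sum_prod_type,
    Matrix.kroneckerMap_apply, h, Pi.sub_apply]
  rw [Finset.sum_comm]
  simp only [sub_mul, ite_mul, one_mul, zero_mul, Finset.sum_sub_distrib, Finset.sum_ite_eq',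
    Finset.mem_univ, if_true, mul_sub]

lemma curry_L_transpose_kronecker_mulVec (m : ℕ) (A : Matrix (Fin 3) (Fin 3) ℝ)
    (z : ZMod n × Fin 3 → ℝ) (i : ZMod n) :
    Function.curry (((L n m)ᵀ ⊗ₖ A) *ᵥ z) i =
      A *ᵥ (Function.curry z i - Function.curry z (i + -m)) := by
  have h : ∀ j : ZMod n, L n m j i = (if j = i then 1 else 0) - (if j = i + -m then 1 else 0) := by
    intro j
    have e1 : (i = j) ↔ (j = i) := eq_comm
    have e2 : (i = (m : ZMod n) + j) ↔ (j = i + -m) := by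
      constructor <;> intro h
      · rw [h]; ring
      · rw [h]; ring
    simp [L, circ, Pi.single_apply, sub_eq_iff_eq_add, e1, e2]
  ext a
  simp only [Function.curry, Matrix.mulVec, dotProduct, Fintype.sum_prod_type,
    Matrix.kroneckerMap_apply, Matrix.transpose_apply, h, Pi.sub_apply]
  rw [Finset.sum_comm]
  simp only [sub_mul, ite_mul, one_mul, zero_mul, Finset.sum_sub_distrib, Finset.sum_ite_eq',
    Finset.mem_univ, if_true, mul_sub]

lemma rot_transpose (θ : ℝ) : (rot θ)ᵀ = rot (-θ) := by
  ext i j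
  fin_cases i <;> fin_cases j <;> simp [rot]

lemma rot_zero : rot 0 = 1 := by
  ext i j
  fin_cases i <;> fin_cases j <;> simp [rot]

lemma hasSymbol_of_curry {A : StateMatrix n} {θ : ℝ} {m : ZMod n}
    (h : ∀ z i, Function.curry (A *ᵥ z) i =
      rot θ *ᵥ (Function.curry z i - Function.curry z (i + m))) :
    HasSymbol A fun k q => (1 - stdAddChar (m * q)) * Complex.exp ((k * θ : ℝ) * Complex.I) := by
  intro z k hk q
  obtain ⟨f, hf⟩ : ∃ f : ZMod n → ℂ, f = fun i => rotCovector k (Function.curry z i) := ⟨_, rfl⟩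
  have e : (fun i => rotCovector k (Function.curry (A *ᵥ z) i)) =
      Complex.exp ((k * θ : ℝ) * Complex.I) • (f - fun i => f (i + m)) := by
    ext i
    simp only [h, hf, rotCovector_rot_mulVec hk, rotCovector_sub, Pi.smul_apply, Pi.sub_apply,
      smul_eq_mul]
  rw [mode, e, _root_.map_smul, map_sub, Pi.smul_apply, Pi.sub_apply, dft_comp_add, mode, ← hf,
    smul_eq_mul]
  ring

lemma hasSymbol_L_kronecker (m : ℕ) (θ : ℝ) :
    HasSymbol (L n m ⊗ₖ rot θ) fun k q =>
      (1 - stdAddChar ((m : ZMod n) * q)) * Complex.exp ((k * θ : ℝ) * Complex.I) :=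
  hasSymbol_of_curry fun z i => curry_L_kronecker_mulVec m _ z i

lemma hasSymbol_L_transpose_kronecker (m : ℕ) (θ : ℝ) :
    HasSymbol ((L n m)ᵀ ⊗ₖ (rot θ)ᵀ) fun k q => (starRingEnd ℂ)
      ((1 - stdAddChar ((m : ZMod n) * q)) * Complex.exp ((k * θ : ℝ) * Complex.I)) := by
  refine (hasSymbol_of_curry (θ := -θ) (m := -(m : ZMod n)) fun z i => ?_).congr fun k _ q => ?_
  · rw [curry_L_transpose_kronecker_mulVec, rot_transpose]
  · rw [map_mul (starRingEnd ℂ), map_sub (starRingEnd ℂ), map_one, ← AddChar.map_neg_eq_conj,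
      ← Complex.exp_conj, neg_mul]
    simp

/-- The symbol of `L_m ⊗ R_m + L_mᵀ ⊗ R_mᵀ`. -/
noncomputable def pairSymbol (m : ℕ) (a : ℝ) (k : ℤ) (q : ZMod n) : ℝ :=
  2 * ((1 - stdAddChar ((m : ZMod n) * q)) * Complex.exp ((k * a : ℝ) * Complex.I)).re

lemma hasSymbol_cyclicMatrix (N : ℕ) (k α : ℕ → ℝ) :
    HasSymbol (cyclicMatrix n N k α) fun κ q =>
      ((∑ m ∈ Finset.Icc 1 N, k m * pairSymbol m (α m) κ q : ℝ) : ℂ) := by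
  refine (HasSymbol.sum (Finset.Icc 1 N) fun m _ =>
    ((hasSymbol_L_kronecker m (α m)).add
      (hasSymbol_L_transpose_kronecker m (α m))).smul (k m)).congr fun κ _ q => ?_
  simp only [Complex.add_conj, pairSymbol]
  push_cast
  rfl

/-- The symbol of `P_n`. -/
noncomputable def pSymbol (k : ℤ) (q : ZMod n) : ℂ :=
  (1 - stdAddChar q) * (1 - stdAddChar (q + (k : ZMod n)))

lemma exp_mul_two_pi_div (k : ℤ) :
    Complex.exp ((k * (2 * Real.pi / n) : ℝ) * Complex.I) = stdAddChar (k : ZMod n) := by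
  rw [stdAddChar_coe]
  congr 1
  push_cast
  ring

lemma stdAddChar_two_mul (q : ZMod n) : stdAddChar (2 * q) = (stdAddChar q) ^ 2 := by
  rw [two_mul, AddChar.map_add_eq_mul, sq]

lemma hasSymbol_P : HasSymbol (P n) pSymbol := by
  have h : P n = L n 1 ⊗ₖ rot 0 +
      (L n 1 ⊗ₖ rot (2 * Real.pi / n) + (-1 : ℝ) • (L n 2 ⊗ₖ rot (2 * Real.pi / n))) := by
    rw [P, rot_zero, sub_eq_add_neg, Matrix.add_kronecker, ← neg_one_smul ℝ (L n 2),
      Matrix.smul_kronecker]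
  rw [h]
  refine ((hasSymbol_L_kronecker 1 0).add ((hasSymbol_L_kronecker 1 _).add
    ((hasSymbol_L_kronecker 2 _).smul (-1)))).congr fun k _ q => ?_
  simp only [exp_mul_two_pi_div, pSymbol, AddChar.map_add_eq_mul]
  simp [stdAddChar_two_mul]
  ring

lemma hasSymbol_P_transpose :
    HasSymbol (P n)ᵀ fun k q => (starRingEnd ℂ) (pSymbol k q) := by
  have h : (P n)ᵀ = (L n 1)ᵀ ⊗ₖ (rot 0)ᵀ + ((L n 1)ᵀ ⊗ₖ (rot (2 * Real.pi / n))ᵀ +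
      (-1 : ℝ) • ((L n 2)ᵀ ⊗ₖ (rot (2 * Real.pi / n))ᵀ)) := by
    rw [P, rot_zero, sub_eq_add_neg, Matrix.add_kronecker, ← neg_one_smul ℝ (L n 2),
      Matrix.smul_kronecker]
    simp only [Matrix.transpose_add, Matrix.transpose_smul, Matrix.kroneckerMap_transpose]
  rw [h]
  refine ((hasSymbol_L_transpose_kronecker 1 0).add ((hasSymbol_L_transpose_kronecker 1 _).add
    ((hasSymbol_L_transpose_kronecker 2 _).smul (-1)))).congr fun k _ q => ?_
  simp only [exp_mul_two_pi_div, pSymbol, AddChar.map_add_eq_mul]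
  simp [stdAddChar_two_mul]
  ring

lemma stdAddChar_eq_one_iff (q : ZMod n) : stdAddChar q = (1 : ℂ) ↔ q = 0 := by
  rw [← AddChar.map_zero_eq_one (stdAddChar : AddChar (ZMod n) ℂ)]
  exact injective_stdAddChar.eq_iff

lemma pSymbol_eq_zero_iff (k : ℤ) (q : ZMod n) : pSymbol k q = 0 ↔ q = 0 ∨ q + k = 0 := by
  rw [pSymbol, mul_eq_zero, sub_eq_zero, sub_eq_zero, eq_comm, stdAddChar_eq_one_iff,
    eq_comm (a := (1 : ℂ)), stdAddChar_eq_one_iff]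

lemma normSq_one_sub_stdAddChar (q : ZMod n) :
    (Complex.normSq (1 - stdAddChar q) : ℂ) = -(stdAddChar q - 1) ^ 2 / stdAddChar q := by
  have h : (stdAddChar q : ℂ) * stdAddChar (-q) = 1 := by
    rw [← AddChar.map_add_eq_mul, add_neg_cancel, AddChar.map_zero_eq_one]
  have h0 : (stdAddChar q : ℂ) ≠ 0 := left_ne_zero_of_mul_eq_one h
  rw [Complex.normSq_eq_conj_mul_self, map_sub, map_one, ← AddChar.map_neg_eq_conj,
    eq_div_iff h0]
  linear_combination (stdAddChar q - 1 : ℂ) * h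

/-- The number `λ_{ik}^{(m)}` is the symbol of `P_n (L_m ⊗ R_m + L_mᵀ ⊗ R_mᵀ) P_nᵀ` at the
frequencies `i - 1` and `k`. -/
lemma modeEigenvalue_eq_normSq_mul (m : ℕ) (a : ℝ) (i k : ℤ) :
    modeEigenvalue n m a i k =
      Complex.normSq (pSymbol k ((i - 1 : ℤ) : ZMod n)) *
        pairSymbol m a k ((i - 1 : ℤ) : ZMod n) := by
  apply Complex.ofReal_injective
  have h1 : Complex.exp (2 * Real.pi * ((i : ℂ) - 1) * Complex.I / n) =
      stdAddChar ((i - 1 : ℤ) : ZMod n) := by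
    rw [stdAddChar_coe]; congr 1; push_cast; ring
  have h2 : Complex.exp (2 * Real.pi * ((i : ℂ) - 1 + k) * Complex.I / n) =
      stdAddChar (((i - 1 : ℤ) : ZMod n) + (k : ZMod n)) := by
    rw [← Int.cast_add, stdAddChar_coe]; congr 1; push_cast; ring
  have h3 : Complex.exp (2 * Real.pi * (2 * ((i : ℂ) - 1) + k) * Complex.I / n) =
      stdAddChar ((i - 1 : ℤ) : ZMod n) * stdAddChar (((i - 1 : ℤ) : ZMod n) + (k : ZMod n)) := by
    rw [← h1, ← h2, ← Complex.exp_add]; congr 1; ring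
  have h4 : pairSymbol m a k ((i - 1 : ℤ) : ZMod n) =
      2 * (Real.cos (k * a) - Real.cos (k * a + 2 * Real.pi * m * ((i : ℝ) - 1) / n)) := by
    have e : stdAddChar ((m : ZMod n) * ((i - 1 : ℤ) : ZMod n)) =
        Complex.exp ((2 * Real.pi * m * ((i : ℝ) - 1) / n : ℝ) * Complex.I) := by
      rw [← Int.cast_natCast, ← Int.cast_mul, stdAddChar_coe]; congr 1; push_cast; ring
    rw [pairSymbol, e, sub_mul, one_mul, ← Complex.exp_add, ← add_mul, ← Complex.ofReal_add,
      Complex.sub_re, Complex.exp_ofReal_mul_I_re, Complex.exp_ofReal_mul_I_re, add_comm (k * a)]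
  have n1 : (stdAddChar ((i - 1 : ℤ) : ZMod n) : ℂ) ≠ 0 := h1 ▸ Complex.exp_ne_zero _
  have n2 : (stdAddChar (((i - 1 : ℤ) : ZMod n) + (k : ZMod n)) : ℂ) ≠ 0 := h2 ▸ Complex.exp_ne_zero _
  rw [modeEigenvalue_eq, modeEigenvalueC, h1, h2, h3, h4, pSymbol, Complex.normSq_mul]
  rw [Complex.ofReal_mul, Complex.ofReal_mul, normSq_one_sub_stdAddChar,
    normSq_one_sub_stdAddChar, Complex.ofReal_mul 2]
  push_cast
  field_simp

lemma mem_transverseModes {k : ℤ} (hk : k ∈ Finset.Icc (-1 : ℤ) 1) {q : ZMod n}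
    (h : pSymbol k q ≠ 0) : ((q.val : ℤ) + 1, k) ∈ transverseModes n := by
  have e : ((q.val : ℤ) : ZMod n) = q := by simp
  have hq := ZMod.val_lt q
  rw [Ne, pSymbol_eq_zero_iff, not_or] at h
  simp only [transverseModes, Finset.mem_filter, Finset.mem_product, hk, and_true,
    Finset.mem_Icc, add_sub_cancel_right]
  refine ⟨by omega, fun hd => h.1 ?_, fun hd => h.2 ?_⟩
  · rwa [← ZMod.intCast_zmod_eq_zero_iff_dvd, e] at hd
  · rwa [← ZMod.intCast_zmod_eq_zero_iff_dvd, Int.cast_add, e] at hd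

/-- On the range of `P_n`, the matrix `P_n 𝓛 P_nᵀ` is bounded below by the minimal mode sum: the
modes at which its symbol is not controlled are those killed by `P_n`. -/
lemma minModeSum_mul_le (hn : 3 ≤ n) (N : ℕ) (k α : ℕ → ℝ) (w : ZMod n × Fin 3 → ℝ) :
    minModeSum n N hn k α * (P n *ᵥ w ⬝ᵥ P n *ᵥ w) ≤
      P n *ᵥ w ⬝ᵥ (P n * cyclicMatrix n N k α * (P n)ᵀ) *ᵥ (P n *ᵥ w) := by
  have hS : HasSymbol (P n * cyclicMatrix n N k α * (P n)ᵀ) fun κ q =>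
      ((∑ m ∈ Finset.Icc 1 N, k m * modeEigenvalue n m (α m) (q.val + 1) κ : ℝ) : ℂ) := by
    refine ((hasSymbol_P.mul (hasSymbol_cyclicMatrix N k α)).mul hasSymbol_P_transpose).congr
      fun κ _ q => ?_
    have e : (((q.val : ℤ) + 1 - 1 : ℤ) : ZMod n) = q := by simp
    simp only [modeEigenvalue_eq_normSq_mul, e]
    rw [mul_right_comm, Complex.mul_conj, ← Complex.ofReal_mul, Finset.mul_sum]
    congr 1
    exact Finset.sum_congr rfl fun m _ => by ring
  have hI : HasSymbol (minModeSum n N hn k α • (1 : StateMatrix n)) fun _ _ =>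
      ((minModeSum n N hn k α : ℝ) : ℂ) := fun z κ _ q => by
    rw [Matrix.smul_mulVec, Matrix.one_mulVec, mode_smul]
  have hpos : (0 : ℝ) < n := Nat.cast_pos.2 (by omega)
  refine le_of_mul_le_mul_left ?_ hpos
  rw [hS.dotProduct_mulVec]
  have h2 := hI.dotProduct_mulVec (P n *ᵥ w)
  rw [Matrix.smul_mulVec, Matrix.one_mulVec, dotProduct_smul, smul_eq_mul] at h2
  rw [h2]
  refine Finset.sum_le_sum fun κ hκ => Finset.sum_le_sum fun q _ =>
    mul_le_mul_of_nonneg_left ?_ (rotWeight_nonneg κ)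
  by_cases hp : pSymbol κ q = 0
  · simp [hasSymbol_P w κ hκ q, hp]
  · exact mul_le_mul_of_nonneg_right (Finset.inf'_le (fun p : ℤ × ℤ =>
      ∑ m ∈ Finset.Icc 1 N, k m * modeEigenvalue n m (α m) p.1 p.2) (mem_transverseModes hκ hp))
      (Complex.normSq_nonneg _)

/-! ### The formation subspace is the kernel of `P_n` -/

lemma curry_P_mulVec (z : ZMod n × Fin 3 → ℝ) (i : ZMod n) :
    Function.curry (P n *ᵥ z) i = Function.curry z i - Function.curry z (i + 1) +
      rot (2 * Real.pi / n) *ᵥ (Function.curry z (i + 2) - Function.curry z (i + 1)) := by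
  have h : P n *ᵥ z = (L n 1 ⊗ₖ (1 : Matrix (Fin 3) (Fin 3) ℝ)) *ᵥ z +
      ((L n 1 ⊗ₖ rot (2 * Real.pi / n)) *ᵥ z - (L n 2 ⊗ₖ rot (2 * Real.pi / n)) *ᵥ z) := by
    rw [← Matrix.sub_mulVec, ← Matrix.add_mulVec, P, sub_eq_add_neg (L n 1), Matrix.add_kronecker,
      ← neg_one_smul ℝ (L n 2), Matrix.smul_kronecker, neg_one_smul, sub_eq_add_neg]
  have h' : Function.curry (P n *ᵥ z) i =
      Function.curry ((L n 1 ⊗ₖ (1 : Matrix (Fin 3) (Fin 3) ℝ)) *ᵥ z) i +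
      (Function.curry ((L n 1 ⊗ₖ rot (2 * Real.pi / n)) *ᵥ z) i -
        Function.curry ((L n 2 ⊗ₖ rot (2 * Real.pi / n)) *ᵥ z) i) := by
    rw [h]; rfl
  rw [h', curry_L_kronecker_mulVec, curry_L_kronecker_mulVec, curry_L_kronecker_mulVec,
    Matrix.one_mulVec, ← Matrix.mulVec_sub]
  push_cast
  congr 2
  abel

lemma mem_formation_of_P_mulVec_eq_zero {x : State n} (h : P n *ᵥ x.ofLp = 0) :
    x ∈ formation n := by
  have key : ∀ i : ZMod n,
      pos x (i + 1) - pos x i = rot (2 * Real.pi / n) *ᵥ (pos x (i + 2) - pos x (i + 1)) := by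
    intro i
    have h1 := curry_P_mulVec x.ofLp i
    rw [h] at h1
    have h2 : (0 : Fin 3 → ℝ) = pos x i - pos x (i + 1) +
      rot (2 * Real.pi / n) *ᵥ (pos x (i + 2) - pos x (i + 1)) := h1
    rw [← sub_eq_zero, ← neg_eq_zero, h2]
    abel
  refine ⟨fun i _ => key i, ?_⟩
  have h1 := congrFun (key (-2)) 2
  have e1 : (-2 + 1 : ZMod n) = -1 := by ring
  have e2 : (-2 + 2 : ZMod n) = 0 := by ring
  rw [e1, e2] at h1
  rw [h1]
  simp [rot, Matrix.mulVec, dotProduct, Fin.sum_univ_three]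

lemma val_add_two_lt {i : ZMod n} (h1 : i ≠ -1) (h2 : i ≠ -2) : i.val + 2 < n := by
  have hi := ZMod.val_lt i
  by_contra hcon
  have e : ((i.val : ℕ) : ZMod n) = i := by simp
  obtain h | h : i.val + 1 = n ∨ i.val + 2 = n := by omega
  · refine h1 (eq_neg_of_add_eq_zero_left ?_)
    rw [← e, ← Nat.cast_one, ← Nat.cast_add, h, ZMod.natCast_self]
  · refine h2 (eq_neg_of_add_eq_zero_left ?_)
    rw [← e, ← Nat.cast_two, ← Nat.cast_add, h, ZMod.natCast_self]

/-- A state in the formation subspace satisfies the constraints left out of its definition as well.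
Only the values of `P_n x` at the last two robots can be nonzero, and the modes of `P_n x` at the
frequencies `0` and `-k` vanish because the symbol of `P_n` does. -/
lemma P_mulVec_eq_zero_of_mem_formation (hn : 3 ≤ n) {x : State n} (h : x ∈ formation n) :
    P n *ᵥ x.ofLp = 0 := by
  have : Fact (1 < n) := ⟨by omega⟩
  obtain ⟨hx, hx'⟩ := h
  set d := P n *ᵥ x.ofLp with hd
  have hblock : ∀ i, Function.curry d i = pos x i - pos x (i + 1) +
      rot (2 * Real.pi / n) *ᵥ (pos x (i + 2) - pos x (i + 1)) := fun i => curry_P_mulVec x.ofLp i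
  have hsupp : ∀ i : ZMod n, i ≠ -1 → i ≠ -2 → Function.curry d i = 0 := by
    intro i h1 h2
    rw [hblock, ← hx i (val_add_two_lt h1 h2)]
    abel
  have hz : Function.curry d (-2) 2 = 0 := by
    have e1 : (-2 + 1 : ZMod n) = -1 := by ring
    have e2 : (-2 + 2 : ZMod n) = 0 := by ring
    rw [hblock, e1, e2]
    simp only [Pi.sub_apply] at hx'
    simp [rot, dotProduct, Fin.sum_univ_three]
    linarith
  have hne : (-1 : ZMod n) ≠ -2 := by
    intro h
    have h' : (1 : ZMod n) = 0 := by linear_combination h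
    exact one_ne_zero h'
  have hmode : ∀ (k : ℤ) (q : ZMod n), mode k q d =
      stdAddChar q * rotCovector k (Function.curry d (-1)) +
        stdAddChar (2 * q) * rotCovector k (Function.curry d (-2)) := by
    intro k q
    rw [mode, dft_apply, Fintype.sum_eq_add (-1) (-2) hne]
    · simp
    · rintro i ⟨h1, h2⟩
      rw [hsupp i h1 h2, rotCovector_zero, smul_zero]
  have hmem : ∀ k : ℤ, k = 0 ∨ k = 1 → k ∈ Finset.Icc (-1 : ℤ) 1 := by
    rintro k (rfl | rfl) <;> simp
  have hvan : ∀ k : ℤ, k = 0 ∨ k = 1 → ∀ q : ZMod n, q = 0 ∨ q + k = 0 → mode k q d = 0 := by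
    intro k hk q hq
    rw [hd, hasSymbol_P _ k (hmem k hk), (pSymbol_eq_zero_iff k q).2 hq, zero_mul]
  -- The vertical coordinate: one frequency for the one remaining unknown.
  have hz' : Function.curry d (-1) 2 = 0 := by
    have h1 := hvan 0 (Or.inl rfl) 0 (Or.inl rfl)
    rw [hmode] at h1
    simp only [rotCovector, if_true, hz] at h1
    simpa using h1
  -- The horizontal coordinates: two frequencies for two unknowns.
  have h1 := hvan 1 (Or.inr rfl) 0 (Or.inl rfl)
  have h2 := hvan 1 (Or.inr rfl) (-1) (Or.inr (by simp))
  rw [hmode, stdAddChar_two_mul] at h1 h2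
  rw [AddChar.map_zero_eq_one] at h1
  have hc : (stdAddChar (-1 : ZMod n) : ℂ) ≠ 1 := by
    rw [Ne, stdAddChar_eq_one_iff, neg_eq_zero]
    exact one_ne_zero
  have hc0 : (stdAddChar (-1 : ZMod n) : ℂ) ≠ 0 := by
    rw [stdAddChar_apply]
    exact Circle.coe_ne_zero _
  have hb : rotCovector 1 (Function.curry d (-2)) = 0 := by
    refine (mul_eq_zero.1 ?_).resolve_left (mul_ne_zero hc0 (sub_ne_zero.2 hc))
    linear_combination h2 - stdAddChar (-1 : ZMod n) * h1
  have ha : rotCovector 1 (Function.curry d (-1)) = 0 := by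
    rw [hb] at h1
    simpa using h1
  have hzero : ∀ v : Fin 3 → ℝ, rotCovector 1 v = 0 → v 2 = 0 → v = 0 := by
    intro v h h'
    have hre := congrArg Complex.re h
    have him := congrArg Complex.im h
    simp [rotCovector] at hre him
    ext a
    fin_cases a <;> assumption
  ext ⟨i, a⟩
  have hi : Function.curry d i = 0 := by
    by_cases e1 : i = -1
    · rw [e1]; exact hzero _ ha hz'
    by_cases e2 : i = -2
    · rw [e2]; exact hzero _ hb hz
    exact hsupp i e1 e2
  exact congrFun hi a

/-! ### Linear algebra -/

/-- The Rayleigh quotient of `A` is at most `λ_max(A)`. -/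
lemma dotProduct_mulVec_le_lambdaMax {ι : Type*} [Fintype ι] [DecidableEq ι] (A : Matrix ι ι ℝ)
    (z : ι → ℝ) : z ⬝ᵥ A *ᵥ z ≤ lambdaMax A * (z ⬝ᵥ z) := by
  have hA := symPart_isHermitian A
  set b := hA.eigenvectorBasis with hb
  have hquad : z ⬝ᵥ A *ᵥ z = z ⬝ᵥ symPart A *ᵥ z := by
    have h : z ⬝ᵥ Aᵀ *ᵥ z = z ⬝ᵥ A *ᵥ z := by
      rw [Matrix.mulVec_transpose, Matrix.dotProduct_mulVec, dotProduct_comm]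
    rw [symPart, Matrix.smul_mulVec, Matrix.add_mulVec, dotProduct_smul, dotProduct_add, h,
      smul_eq_mul]
    ring
  have hcoord : ∀ i, (b i).ofLp ⬝ᵥ symPart A *ᵥ z =
      hA.eigenvalues i * ((b i).ofLp ⬝ᵥ z) := by
    intro i
    have hs : (symPart A)ᵀ = symPart A := by simpa using! hA.eq
    rw [Matrix.dotProduct_mulVec, ← Matrix.mulVec_transpose, hs, hA.mulVec_eigenvectorBasis,
      smul_dotProduct, smul_eq_mul]
  have hexp : ∀ v w : ι → ℝ, v ⬝ᵥ w = ∑ i, ((b i).ofLp ⬝ᵥ v) * ((b i).ofLp ⬝ᵥ w) := by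
    intro v w
    have h := b.sum_inner_mul_inner (WithLp.toLp 2 v) (WithLp.toLp 2 w)
    simp only [EuclideanSpace.inner_eq_star_dotProduct, star_trivial] at h
    rw [dotProduct_comm v w, ← h]
    exact Finset.sum_congr rfl fun i _ => by rw [dotProduct_comm w]
  rw [hquad, hexp z, hexp z z, Finset.mul_sum]
  refine Finset.sum_le_sum fun i _ => ?_
  rw [hcoord, mul_left_comm]
  exact mul_le_mul_of_nonneg_right (le_ciSup (Set.finite_range hA.eigenvalues).bddAbove i)
    (mul_self_nonneg _)

lemma exists_mulVec_dotProduct_mulVec_le {ι : Type*} [Fintype ι] [DecidableEq ι]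
    (A : Matrix ι ι ℝ) : ∃ C > 0, ∀ z : ι → ℝ, (A *ᵥ z ⬝ᵥ A *ᵥ z) ≤ C * (z ⬝ᵥ z) := by
  refine ⟨|lambdaMax (Aᵀ * A)| + 1, by positivity, fun z => ?_⟩
  have h := dotProduct_mulVec_le_lambdaMax (Aᵀ * A) z
  rw [← Matrix.mulVec_mulVec, Matrix.dotProduct_mulVec, Matrix.vecMul_transpose] at h
  have h0 : 0 ≤ z ⬝ᵥ z := by simpa using dotProduct_star_self_nonneg z
  exact h.trans (mul_le_mul_of_nonneg_right (by linarith [le_abs_self (lambdaMax (Aᵀ * A))]) h0)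

lemma infDist_eq_norm_starProjection_orthogonal {E : Type*} [NormedAddCommGroup E]
    [InnerProductSpace ℝ E] (K : Submodule ℝ E) [K.HasOrthogonalProjection] (x : E) :
    Metric.infDist x (K : Set E) = ‖Kᗮ.starProjection x‖ := by
  have hx : Kᗮ.starProjection x = x - K.starProjection x := by
    rw [eq_sub_iff_add_eq, add_comm]
    exact K.starProjection_add_starProjection_orthogonal x
  rw [hx, K.starProjection_minimal, Metric.infDist_eq_iInf]
  simp only [dist_eq_norm]
  rfl

lemma exists_eq_P_transpose_mulVec_P_mulVec {y : State n} (hy : y ∈ (formation n)ᗮ) :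
    ∃ w : ZMod n × Fin 3 → ℝ, y.ofLp = (P n)ᵀ *ᵥ (P n *ᵥ w) := by
  have hker : (P n).toEuclideanLin.ker ≤ formation n := fun x hx =>
    mem_formation_of_P_mulVec_eq_zero (congrArg WithLp.ofLp (LinearMap.mem_ker.1 hx))
  have h := Submodule.orthogonal_le hker hy
  rw [LinearMap.orthogonal_ker, ← LinearMap.range_adjoint_comp_self,
    ← Matrix.toEuclideanLin_conjTranspose_eq_adjoint] at h
  obtain ⟨w, hw⟩ := h
  exact ⟨w.ofLp, (congrArg WithLp.ofLp hw).symm⟩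

/-! ### Contraction -/

lemma dotProduct_jacobian_mulVec (g : State n → State n) (x y : State n) :
    y.ofLp ⬝ᵥ jacobian g x *ᵥ y.ofLp = inner ℝ y (fderiv ℝ g x y) := by
  have h : jacobian g x *ᵥ y.ofLp = (fderiv ℝ g x y).ofLp := by
    have e : y = ∑ q, y q • EuclideanSpace.single q (1 : ℝ) := by
      ext p
      simp [Finset.sum_apply, Pi.single_apply]
    ext p
    conv_rhs => rw [e]
    simp [jacobian, Matrix.mulVec, dotProduct, Finset.sum_apply, mul_comm]
  rw [h, EuclideanSpace.inner_eq_star_dotProduct, star_trivial, dotProduct_comm]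

/-- The component of the vector field normal to the formation subspace is dissipative, with a rate
that is controlled by the gap in the contraction condition. -/
lemma inner_starProjection_le (hn : 3 ≤ n) {N : ℕ} {k α : ℕ → ℝ} {g : State n → State n}
    (hg : ContDiff ℝ 1 g) (hinv : ∀ x ∈ formation n, g x ∈ formation n) {ε C : ℝ}
    (hε : 0 < ε) (hC : 0 < C)
    (hgap : ∀ x, lambdaMax (P n * jacobian g x * (P n)ᵀ) - minModeSum n N hn k α ≤ -ε)
    (hP : ∀ z, ((P n)ᵀ *ᵥ z ⬝ᵥ (P n)ᵀ *ᵥ z) ≤ C * (z ⬝ᵥ z)) (x : State n) :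
    inner ℝ ((formation n)ᗮ.starProjection x) (g x + cyclicControl n N k α x) ≤
      -(ε / C) * ‖(formation n)ᗮ.starProjection x‖ ^ 2 := by
  set y := (formation n)ᗮ.starProjection x with hy
  set m := (formation n).starProjection x with hm
  have hx : x = m + y := ((formation n).starProjection_add_starProjection_orthogonal x).symm
  have hmM : m ∈ formation n := (formation n).starProjection_apply_mem x
  have hyM : y ∈ (formation n)ᗮ := (formation n)ᗮ.starProjection_apply_mem x
  obtain ⟨w, hw⟩ := exists_eq_P_transpose_mulVec_P_mulVec hyM
  set z := P n *ᵥ w with hz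
  have hmove : ∀ (A : StateMatrix n) (v : ZMod n × Fin 3 → ℝ),
      y.ofLp ⬝ᵥ A *ᵥ v = z ⬝ᵥ P n *ᵥ (A *ᵥ v) := by
    intro A v
    rw [hw, Matrix.mulVec_transpose, ← Matrix.dotProduct_mulVec]
  -- The nonlinear part, by the mean value theorem on the segment from `m` to `x`.
  obtain ⟨s, _, hs⟩ := exists_hasDerivAt_eq_slope (fun s : ℝ => inner ℝ y (g (m + s • y)))
    (fun s => inner ℝ y (fderiv ℝ g (m + s • y) y)) zero_lt_one
    (by have := hg.continuous; fun_prop)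
    (fun s _ => by
      have h1 : HasDerivAt (fun s : ℝ => m + s • y) y s := by
        simpa using ((hasDerivAt_id s).smul_const y).const_add m
      have h2 := ((hg.differentiable one_ne_zero (m + s • y)).hasFDerivAt).comp_hasDerivAt s h1
      simpa using! (hasDerivAt_const s y).inner ℝ h2)
  have hgm : inner ℝ y (g m) = 0 := by
    rw [real_inner_comm]
    exact hyM _ (hinv m hmM)
  simp only [one_smul, zero_smul, add_zero, ← hx, hgm, sub_zero, div_one] at hs
  have hJ : inner ℝ y (g x) ≤
      lambdaMax (P n * jacobian g (m + s • y) * (P n)ᵀ) * (z ⬝ᵥ z) := by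
    refine le_trans (le_of_eq ?_) (dotProduct_mulVec_le_lambdaMax _ z)
    rw [← hs, ← dotProduct_jacobian_mulVec, hmove, hw, Matrix.mulVec_mulVec, Matrix.mulVec_mulVec]
  -- The controller: the component of `x` in the formation subspace does not contribute.
  have hL : inner ℝ y (cyclicControl n N k α x) ≤ -(minModeSum n N hn k α * (z ⬝ᵥ z)) := by
    have h0 : y.ofLp ⬝ᵥ cyclicMatrix n N k α *ᵥ m.ofLp = 0 := by
      rw [hmove, hasSymbol_P.commute (hasSymbol_cyclicMatrix N k α),
        P_mulVec_eq_zero_of_mem_formation hn hmM, Matrix.mulVec_zero, dotProduct_zero]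
    have h1 : inner ℝ y (cyclicControl n N k α x) =
        -(z ⬝ᵥ (P n * cyclicMatrix n N k α * (P n)ᵀ) *ᵥ z) := by
      rw [EuclideanSpace.inner_eq_star_dotProduct, star_trivial, dotProduct_comm, cyclicControl,
        dotProduct_neg, hx, WithLp.ofLp_add, Matrix.mulVec_add, dotProduct_add, h0, zero_add,
        hmove, hw, Matrix.mulVec_mulVec, Matrix.mulVec_mulVec]
    rw [h1, neg_le_neg_iff]
    exact minModeSum_mul_le hn N k α w
  have hyz : ‖y‖ ^ 2 ≤ C * (z ⬝ᵥ z) := by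
    rw [← real_inner_self_eq_norm_sq, EuclideanSpace.inner_eq_star_dotProduct, star_trivial, hw]
    exact hP z
  have hzz : 0 ≤ z ⬝ᵥ z := by simpa using dotProduct_star_self_nonneg z
  calc inner ℝ y (g x + cyclicControl n N k α x)
      ≤ (lambdaMax (P n * jacobian g (m + s • y) * (P n)ᵀ) - minModeSum n N hn k α) *
          (z ⬝ᵥ z) := by
        rw [inner_add_right, sub_mul]
        linarith
    _ ≤ -ε * (z ⬝ᵥ z) := mul_le_mul_of_nonneg_right (hgap _) hzz
    _ = -(ε / C) * (C * (z ⬝ᵥ z)) := by field_simp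
    _ ≤ -(ε / C) * ‖y‖ ^ 2 :=
        mul_le_mul_of_nonpos_left hyz (neg_nonpos.2 (div_pos hε hC).le)

/-- If the vector field is dissipative in the direction normal to a subspace, the normal component
of a trajectory decays exponentially. -/
lemma norm_starProjection_le_of_isTrajectory {E : Type*} [NormedAddCommGroup E]
    [InnerProductSpace ℝ E] (K : Submodule ℝ E) [K.HasOrthogonalProjection] {f : ℝ → E → E} {c : ℝ}
    (hf : ∀ t x, inner ℝ (K.starProjection x) (f t x) ≤ -c * ‖K.starProjection x‖ ^ 2)
    {t₀ : ℝ} {T : EReal} {x : ℝ → E} (hx : IsTrajectory f t₀ T x) {t : ℝ}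
    (ht : t ∈ timeInterval t₀ T) :
    ‖K.starProjection (x t)‖ ≤ Real.exp (-c * (t - t₀)) * ‖K.starProjection (x t₀)‖ := by
  set Q := K.starProjection with hQ
  have hsub : Set.Icc t₀ t ⊆ timeInterval t₀ T := fun s hs =>
    ⟨hs.1, lt_of_le_of_lt (EReal.coe_le_coe_iff.2 hs.2) ht.2⟩
  set V : ℝ → ℝ := fun s => Real.exp (2 * c * s) * ‖Q (x s)‖ ^ 2 with hV
  have hderiv : ∀ s ∈ Set.Icc t₀ t, HasDerivWithinAt V
      (Real.exp (2 * c * s) * (2 * c) * ‖Q (x s)‖ ^ 2 +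
        Real.exp (2 * c * s) * (2 * inner ℝ (Q (x s)) (Q (f s (x s))))) (Set.Icc t₀ t) s := by
    intro s hs
    have h1 : HasDerivWithinAt (fun s => Q (x s)) (Q (f s (x s))) (Set.Icc t₀ t) s :=
      Q.hasFDerivAt.comp_hasDerivWithinAt s ((hx s (hsub hs)).mono hsub)
    have h2 : HasDerivAt (fun s : ℝ => Real.exp (2 * c * s)) (Real.exp (2 * c * s) * (2 * c)) s := by
      simpa using ((hasDerivAt_id s).const_mul (2 * c)).exp
    exact h2.hasDerivWithinAt.mul h1.norm_sq
  have hanti : AntitoneOn V (Set.Icc t₀ t) := by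
    have hint : ∀ s ∈ interior (Set.Icc t₀ t), s ∈ Set.Icc t₀ t ∧ Set.Icc t₀ t ∈ nhds s :=
      fun s hs => ⟨interior_subset hs, mem_interior_iff_mem_nhds.1 hs⟩
    refine antitoneOn_of_deriv_nonpos (convex_Icc _ _)
      (fun s hs => (hderiv s hs).continuousWithinAt)
      (fun s hs => ((hderiv s (hint s hs).1).hasDerivAt
        (hint s hs).2).differentiableAt.differentiableWithinAt) fun s hs => ?_
    rw [((hderiv s (hint s hs).1).hasDerivAt (hint s hs).2).deriv]
    have hself : inner ℝ (Q (x s)) (Q (f s (x s))) = inner ℝ (Q (x s)) (f s (x s)) := by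
      rw [hQ, ← K.inner_starProjection_left_eq_right,
        K.starProjection_eq_self_iff.2 (K.starProjection_apply_mem _)]
    rw [hself]
    nlinarith [hf s (x s), Real.exp_pos (2 * c * s)]
  have hmain := hanti (Set.left_mem_Icc.2 ht.1) (Set.right_mem_Icc.2 ht.1) ht.1
  refine le_of_sq_le_sq ?_ (by positivity)
  have he : Real.exp (2 * c * t) * (Real.exp (-c * (t - t₀))) ^ 2 = Real.exp (2 * c * t₀) := by
    rw [← Real.exp_nat_mul, ← Real.exp_add]
    congr 1
    push_cast
    ring
  refine le_of_mul_le_mul_left (hmain.trans (le_of_eq ?_)) (Real.exp_pos (2 * c * t))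
  rw [mul_pow, ← mul_assoc, he]

end CyclicPursuit

theorem theorem3 (n : ℕ) [NeZero n] (hn : 3 ≤ n) (N : ℕ) (hN : 0 < N) (hNn : N < n - 1)
    (k α : ℕ → ℝ → ℝ) (hk : ∀ m ∈ Finset.Icc 1 N, ∀ t, 0 < k m t)
    (g : State n → State n) (hg : ContDiff ℝ 1 g)
    (hinv : ∀ x ∈ formation n, g x ∈ formation n)
    (hcond : (⨆ (x : State n) (t : ℝ),
      ((lambdaMax (P n * jacobian g x * (P n)ᵀ) -
        minModeSum n N hn (fun m => k m t) (fun m => α m t) : ℝ) : EReal)) < 0) :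
    ∃ c > 0, ∃ K > 0, ∀ (t₀ : ℝ) (T : EReal) (x : ℝ → State n),
      IsTrajectory (fun t y => g y + cyclicControl n N (fun m => k m t) (fun m => α m t) y) t₀ T x →
      ∀ t ∈ timeInterval t₀ T,
        Metric.infDist (x t) (formation n : Set (State n)) ≤
          K * Real.exp (-c * (t - t₀)) *
            Metric.infDist (x t₀) (formation n : Set (State n)) := by
  obtain ⟨r, hr, hr0⟩ := EReal.lt_iff_exists_real_btwn.1 hcond
  have hε : 0 < -r := neg_pos.2 (by exact_mod_cast hr0)
  obtain ⟨C, hC, hP⟩ := exists_mulVec_dotProduct_mulVec_le (P n)ᵀ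
  have hgap : ∀ t x, lambdaMax (P n * jacobian g x * (P n)ᵀ) -
      minModeSum n N hn (fun m => k m t) (fun m => α m t) ≤ -(-r) := by
    intro t x
    rw [neg_neg]
    exact EReal.coe_le_coe_iff.1 ((le_iSup₂ (f := fun (x : State n) (t : ℝ) =>
      ((lambdaMax (P n * jacobian g x * (P n)ᵀ) -
        minModeSum n N hn (fun m => k m t) (fun m => α m t) : ℝ) : EReal)) x t).trans hr.le)
  refine ⟨-r / C, div_pos hε hC, 1, one_pos, fun t₀ T x hx t ht => ?_⟩
  rw [infDist_eq_norm_starProjection_orthogonal, infDist_eq_norm_starProjection_orthogonal,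
    one_mul]
  exact norm_starProjection_le_of_isTrajectory _
    (fun t y => inner_starProjection_le hn hg hinv hε hC (hgap t) hP y) hx ht
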